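/- A frequency is a strictly increasing sequence $\lambda=(\lambda_n)_{n\ge 1}$ of non-negative real numbers with $\lambda_n\to\infty$. Let $f$ be a holomorphic function on $\{\operatorname{Re} s>0\}$. A Dirichlet series $\sum_n a_n e^{-\lambda_n s}$ with $a_n\in\mathbb{C}$ is called a $\lambda$-Riesz germ of $f$ if there are $m\ge 0$ and $\sigma_0\ge 0$ such that $$f(s)=\lim_{x\to\infty}\ \sum_{\lambda_n<x} a_n e^{-\lambda_n s}\Big(1-\frac{\lambda_n}{x}\Big)^m\qquad\text{for all } s \text{ with } \operatorname{Re} s>\sigma_0 .$$ For $\ell\ge 0$ let $H_{\infty,\ell}^{\lambda}[\operatorname{Re}>0]$ be the space of all holomorphic functions $f$ on $\{\operatorname{Re} s>0\}$ which have a $\lambda$-Riesz germ and satisfy $$\|f\|_{\infty,\ell}=\sup_{\operatorname{Re} s>0}\frac{|f(s)|}{(1+|s|)^{\ell}}<\infty .$$ **Theorem.** Let $\ell\ge 0$ and let $\lambda$ be a frequency with $\lambda_1>0$. Then for every $f\in H_{\infty,\ell}^{\lambda}[\operatorname{Re}>0]$ $$\lim_{\sigma\to\infty}\ \sup_{\operatorname{Re}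 s>\sigma}\frac{|f(s)|}{(1+|s|)^{\ell}}=0 \qquad\text{and}\qquad \lim_{\sigma\to\infty}\ \sup_{\delta\ge\sigma,\ t\in\mathbb{R}}\frac{|f(\delta+it)|}{(1+|t|)^{\ell}}=0 ,$$ where the suprema are taken in $[0,\infty]$. -/

import Mathlib

/-- A frequency: a strictly increasing sequence of non-negative real numbers tending to infinity.
The sequence is indexed from `0`, so that the first frequency `λ₁` is `toFun 0`. -/
structure Frequency where
  toFun : ℕ → ℝ
  strictMono : StrictMono toFun
  nonneg : ∀ n, 0 ≤ toFun n
  tendsto_atTop : Filter.Tendsto toFun Filter.atTop Filter.atTop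

instance : CoeFun Frequency (fun _ => ℕ → ℝ) := ⟨Frequency.toFun⟩

theorem Frequency.finite_lt (lam : Frequency) (x : ℝ) : {n : ℕ | lam n < x}.Finite := by
  obtain ⟨N, hN⟩ := (lam.tendsto_atTop.eventually_ge_atTop x).exists_forall_of_atTop
  exact (Set.finite_lt_nat N).subset fun n hn => by
    by_contra h
    exact absurd (hN n (not_lt.mp h)) (not_le.mpr hn)

/-- The finite set of all indices `n` with `λ_n < x`. -/
noncomputable def Frequency.below (lam : Frequency) (x : ℝ) : Finset ℕ :=
  (lam.finite_lt x).toFinset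

/-- The Riesz mean `∑_{λ_n < x} a_n e^{-λ_n s} (1 - λ_n / x)^m` of order `m` of the Dirichlet
series `∑ a_n e^{-λ_n s}`, evaluated at `s` (to be used for `x > 0`). -/
noncomputable def rieszMean (lam : Frequency) (m : ℝ) (a : ℕ → ℂ) (x : ℝ) (s : ℂ) : ℂ :=
  ∑ n ∈ lam.below x,
    a n * Complex.exp (-(lam n : ℂ) * s) * (((1 - lam n / x) ^ m : ℝ) : ℂ)

/-- The Dirichlet series `∑ a_n e^{-λ_n s}` is a Riesz germ of the function `f`, given on the open
right half-plane: for some order `m ≥ 0`, its Riesz means of order `m` converge to `f` at every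
point of the right half-plane that lies in some half-plane `Re s > σ`. -/
def IsRieszGerm (lam : Frequency) (a : ℕ → ℂ) (f : ℂ → ℂ) : Prop :=
  ∃ m : ℝ, 0 ≤ m ∧ ∃ σ : ℝ, ∀ s : ℂ, 0 < s.re → σ < s.re →
    Filter.Tendsto (fun x : ℝ => rieszMean lam m a x s) Filter.atTop (nhds (f s))

/-- The norm `sup_{Re s > 0} |f(s)| / (1 + |s|)^ℓ`, as an element of `[0, ∞]`. -/
noncomputable def growthNorm (l : ℝ) (f : ℂ → ℂ) : ENNReal :=
  ⨆ (s : ℂ) (_ : 0 < s.re), ENNReal.ofReal (‖f s‖ / (1 + ‖s‖) ^ l)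

/-- The space of all holomorphic functions on the open right half-plane which have a Riesz germ
with respect to `lam` and whose growth norm of exponent `l` is finite. Functions on the half-plane
are represented by functions on `ℂ` whose values outside the half-plane play no role. -/
def RieszHolSpace (lam : Frequency) (l : ℝ) : Set (ℂ → ℂ) :=
  {f | DifferentiableOn ℂ f {s : ℂ | 0 < s.re} ∧
    (∃ a : ℕ → ℂ, IsRieszGerm lam a f) ∧ growthNorm l f < ⊤}

/-! A germ need not converge absolutely, so the decay of `f` cannot be read off term by term. By
consistency (`tendsto_rieszMean_of_le`) the order may be taken to be a natural number `M ≥ 1`.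
Repeated integration by parts writes the mean of order `M + 1` at `s + u` as an integral of the
means of order `M` at `s` (`rieszMean_add_eq_integral`). These are bounded, and vanish up to the
first frequency `λ₁ > 0`, so the kernel `e^{-uy}` yields decay in `u`, uniform in `x`
(`norm_rieszMean_add_le`). Hence `f` decays like `e^{-cx}` along the real axis. Polynomial growth
and Phragmén–Lindelöf carry this over to the bound `A (1 + |s|)^ℓ e^{-c Re s}` on `Re s ≥ 1`
(`exists_norm_le_mul_exp`), which gives both limits. -/

/-! ### Consistency of Riesz summation -/

-- Substitute `v = l + (1 - l) w`. With `l = λ_n / x`, averaging against a Beta weight raises the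
-- Riesz order from `m` to `m + q + 1`.
open MeasureTheory intervalIntegral Filter Topology Set in
theorem integral_indicator_rpow_mul_rpow {m q l : ℝ} (hl : 0 ≤ l)
    (hl1 : l < 1) :
    ∫ v in (0 : ℝ)..1, (Ioi l).indicator (fun v => (v - l) ^ m * (1 - v) ^ q) v =
      (1 - l) ^ (m + q + 1) * ∫ v in (0 : ℝ)..1, v ^ m * (1 - v) ^ q := by
  have h1 : 0 < 1 - l := by linarith
  rw [integral_of_le zero_le_one, setIntegral_indicator measurableSet_Ioi,
    show Ioc (0 : ℝ) 1 ∩ Ioi l = Ioc l 1 by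
      ext v; simp only [mem_inter_iff, mem_Ioc, mem_Ioi]; grind,
    ← integral_of_le hl1.le]
  have key := mul_integral_comp_mul_add (a := 0) (b := 1)
    (f := fun v : ℝ => (v - l) ^ m * (1 - v) ^ q) (1 - l) l
  rw [mul_zero, zero_add, mul_one, sub_add_cancel] at key
  rw [← key, Real.rpow_add_one h1.ne', Real.rpow_add h1, mul_comm _ (1 - l), mul_assoc (1 - l)]
  congr 1
  rw [← intervalIntegral.integral_const_mul]
  refine intervalIntegral.integral_congr fun w hw => ?_
  rw [uIcc_of_le zero_le_one] at hw
  have e1 : (1 - l) * w + l - l = (1 - l) * w := by ring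
  have e2 : 1 - ((1 - l) * w + l) = (1 - l) * (1 - w) := by ring
  simp only [e1, e2]
  rw [Real.mul_rpow h1.le hw.1, Real.mul_rpow h1.le (by linarith [hw.2])]
  ring

theorem Frequency.mem_below {lam : Frequency} {x : ℝ} {n : ℕ} :
    n ∈ lam.below x ↔ lam n < x := by
  simp [Frequency.below]

theorem Frequency.below_mono (lam : Frequency) {x y : ℝ} (h : x ≤ y) :
    lam.below x ⊆ lam.below y := fun _ hn =>
  Frequency.mem_below.mpr ((Frequency.mem_below.mp hn).trans_le h)

/-- Convergent Riesz means are bounded. -/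
theorem exists_norm_rieszMean_le (lam : Frequency) {m : ℝ} (hm : 0 ≤ m) (a : ℕ → ℂ) (s L : ℂ)
    (h : Filter.Tendsto (fun x : ℝ => rieszMean lam m a x s) Filter.atTop (nhds L)) :
    ∃ K : ℝ, 0 ≤ K ∧ ∀ x : ℝ, 0 < x → ‖rieszMean lam m a x s‖ ≤ K := by
  obtain ⟨X, hX⟩ := (h.norm.eventually_le_const (lt_add_one ‖L‖)).exists_forall_of_atTop
  refine ⟨‖L‖ + 1 + ∑ n ∈ lam.below X, ‖a n * Complex.exp (-(lam n : ℂ) * s)‖, by positivity,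
    fun x hx => ?_⟩
  have hs : 0 ≤ ∑ n ∈ lam.below X, ‖a n * Complex.exp (-(lam n : ℂ) * s)‖ := by positivity
  rcases le_total X x with hXx | hXx
  · linarith [hX x hXx]
  · suffices ‖rieszMean lam m a x s‖ ≤
        ∑ n ∈ lam.below X, ‖a n * Complex.exp (-(lam n : ℂ) * s)‖ by
      linarith [norm_nonneg L]
    refine (norm_sum_le _ _).trans
      (le_trans (Finset.sum_le_sum fun n hn => ?_) (Finset.sum_le_sum_of_subset_of_nonneg
        (lam.below_mono hXx) fun _ _ _ => norm_nonneg _))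
    rw [norm_mul]
    refine mul_le_of_le_one_right (norm_nonneg _) ?_
    have h0 : 0 ≤ lam n / x := div_nonneg (lam.nonneg n) hx.le
    have h1 : lam n / x ≤ 1 := (div_le_one hx).mpr (Frequency.mem_below.mp hn).le
    rw [Complex.norm_real, Real.norm_of_nonneg (Real.rpow_nonneg (by linarith) _)]
    exact Real.rpow_le_one (by linarith) (by linarith) hm

/-- The weighted Riesz mean at `x * v` as a sum over the index set belonging to `x`. -/
theorem rieszMean_mul_rpow (lam : Frequency) (m : ℝ) (a : ℕ → ℂ) (s : ℂ) {x v : ℝ} (hx : 0 < x)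
    (hv : 0 < v) (hv1 : v ≤ 1) (r : ℝ) :
    rieszMean lam m a (x * v) s * ((v ^ m * r : ℝ) : ℂ) =
      ∑ n ∈ lam.below x, a n * Complex.exp (-(lam n : ℂ) * s) *
        (((Set.Ioi (lam n / x)).indicator (fun v => (v - lam n / x) ^ m * r) v : ℝ) : ℂ) := by
  rw [rieszMean, Finset.sum_mul]
  refine Finset.sum_subset_zero_on_sdiff (lam.below_mono (mul_le_of_le_one_right hx.le hv1)) ?_ ?_
  · intro n hn
    have : ¬ lam n / x < v := fun h => (Finset.mem_sdiff.mp hn).2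
      (Frequency.mem_below.mpr (by rwa [div_lt_iff₀' hx] at h))
    simp [this]
  · intro n hn
    have h1 := Frequency.mem_below.mp hn
    have h2 : lam n / x < v := by rwa [div_lt_iff₀' hx]
    rw [Set.indicator_of_mem (show v ∈ Set.Ioi (lam n / x) from h2), mul_assoc (_ * _),
      ← Complex.ofReal_mul, ← mul_assoc (_ ^ m), ← Real.mul_rpow _ hv.le]
    · congr 5
      field_simp
    · rw [sub_nonneg]
      exact (div_le_one (by positivity)).mpr h1.le

open MeasureTheory intervalIntegral Filter Topology Set in
/-- Consistency of Riesz summation: convergence of order `m` implies convergence, with the same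
limit, of every order `≥ m + 1`. -/
theorem tendsto_rieszMean_of_le (lam : Frequency) {m p : ℝ} (hm : 0 ≤ m) (hp : m + 1 ≤ p)
    (a : ℕ → ℂ) (s L : ℂ)
    (h : Tendsto (fun x : ℝ => rieszMean lam m a x s) atTop (𝓝 L)) :
    Tendsto (fun x : ℝ => rieszMean lam p a x s) atTop (𝓝 L) := by
  obtain ⟨q, hq, rfl⟩ : ∃ q : ℝ, 0 ≤ q ∧ p = m + q + 1 := ⟨p - m - 1, by linarith, by ring⟩
  obtain ⟨K, hK, hb⟩ := exists_norm_rieszMean_le lam hm a s L h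
  set w : ℝ → ℝ := fun v => v ^ m * (1 - v) ^ q with hw
  have hwc : Continuous w := by
    refine (continuous_id.rpow_const fun _ => Or.inr hm).mul
      ((continuous_const.sub continuous_id).rpow_const fun _ => Or.inr hq)
  have hwi : IntervalIntegrable w volume 0 1 := hwc.intervalIntegrable _ _
  have hB : 0 < ∫ v in (0 : ℝ)..1, w v := by
    refine intervalIntegral_pos_of_pos_on hwi (fun v hv => ?_) zero_lt_one
    exact mul_pos (Real.rpow_pos_of_pos hv.1 _) (Real.rpow_pos_of_pos (by linarith [hv.2]) _)
  set B := ∫ v in (0 : ℝ)..1, w v with hBdef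
  have hBc : (B : ℂ) ≠ 0 := by exact_mod_cast hB.ne'
  let F : ℝ → ℝ → ℂ := fun x v => ∑ n ∈ lam.below x, a n * Complex.exp (-(lam n : ℂ) * s) *
        (((Ioi (lam n / x)).indicator (fun v => (v - lam n / x) ^ m * (1 - v) ^ q) v : ℝ) : ℂ)
  have hFeq : ∀ x v : ℝ, 0 < x → v ∈ Ioc (0 : ℝ) 1 →
      F x v = rieszMean lam m a (x * v) s * (w v : ℂ) := fun x v hx hv => by
    rw [hw, rieszMean_mul_rpow lam m a s hx hv.1 hv.2]
    rfl
  have hgc : ∀ l : ℝ, Continuous fun v : ℝ => (v - l) ^ m * (1 - v) ^ q := fun l =>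
    ((continuous_id.sub continuous_const).rpow_const fun _ => Or.inr hm).mul
      ((continuous_const.sub continuous_id).rpow_const fun _ => Or.inr hq)
  have hgi : ∀ l : ℝ, IntervalIntegrable (fun v =>
      (((Ioi l).indicator (fun v => (v - l) ^ m * (1 - v) ^ q) v : ℝ) : ℂ)) volume 0 1 := by
    intro l
    rw [intervalIntegrable_iff_integrableOn_Ioc_of_le zero_le_one]
    refine Integrable.ofReal (Integrable.indicator ?_ measurableSet_Ioi)
    have := (hgc l).intervalIntegrable (μ := volume) 0 1
    rwa [intervalIntegrable_iff_integrableOn_Ioc_of_le zero_le_one] at this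
  have hFi : ∀ x, IntervalIntegrable (F x) volume 0 1 := fun x => by
    have := IntervalIntegrable.sum (lam.below x) fun n _ => (hgi (lam n / x)).const_mul
      (a n * Complex.exp (-(lam n : ℂ) * s))
    rwa [Finset.sum_fn] at this
  have hint : ∀ x : ℝ, 0 < x →
      ∫ v in (0 : ℝ)..1, F x v = rieszMean lam (m + q + 1) a x s * B := by
    intro x hx
    rw [integral_finsetSum fun n _ => (hgi _).const_mul _, rieszMean, Finset.sum_mul]
    refine Finset.sum_congr rfl fun n hn => ?_
    rw [intervalIntegral.integral_const_mul, intervalIntegral.integral_ofReal,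
      integral_indicator_rpow_mul_rpow (div_nonneg (lam.nonneg n) hx.le)
        ((div_lt_one hx).mpr (Frequency.mem_below.mp hn)), Complex.ofReal_mul, mul_assoc (_ * _)]
  -- For fixed `v > 0` the mean at `x * v` tends to `L`; boundedness of the means supplies the
  -- dominating function.
  have hlim : Tendsto (fun x => ∫ v in (0 : ℝ)..1, F x v) atTop
      (𝓝 (∫ v in (0 : ℝ)..1, L * (w v : ℂ))) := by
    refine tendsto_integral_filter_of_dominated_convergence (fun v => K * w v)
      (Eventually.of_forall fun x => ?_) ?_ (hwi.const_mul K) ?_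
    · rw [uIoc_of_le zero_le_one]
      exact (hFi x).1.aestronglyMeasurable
    · filter_upwards [eventually_gt_atTop 0] with x hx
      refine Eventually.of_forall fun v hv => ?_
      rw [uIoc_of_le zero_le_one] at hv
      have hw0 : 0 ≤ w v := mul_nonneg (Real.rpow_nonneg hv.1.le _)
        (Real.rpow_nonneg (by linarith [hv.2]) _)
      rw [hFeq x v hx hv, norm_mul, Complex.norm_real, Real.norm_of_nonneg hw0]
      exact mul_le_mul_of_nonneg_right (hb _ (mul_pos hx hv.1)) hw0
    · refine Eventually.of_forall fun v hv => ?_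
      rw [uIoc_of_le zero_le_one] at hv
      refine Tendsto.congr' ?_ ((h.comp (tendsto_id.atTop_mul_const hv.1)).mul_const (w v : ℂ))
      filter_upwards [eventually_gt_atTop 0] with x hx
      exact (hFeq x v hx hv).symm
  rw [intervalIntegral.integral_const_mul, intervalIntegral.integral_ofReal] at hlim
  have := hlim.mul_const (B : ℂ)⁻¹
  rw [mul_inv_cancel_right₀ hBc] at this
  refine this.congr' ?_
  filter_upwards [eventually_gt_atTop 0] with x hx
  rw [hint x hx, mul_inv_cancel_right₀ hBc]

/-! ### Taylor remainder and the truncated exponential -/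

open MeasureTheory intervalIntegral Set in
/-- Taylor's formula with integral remainder at a point where all derivatives up to order `M`
vanish. -/
theorem taylor_integral_remainder_of_eq_zero (G : ℕ → ℝ → ℝ)
    (hG : ∀ k y, HasDerivAt (G k) (G (k + 1) y) y) (l x : ℝ) (M : ℕ)
    (h0 : ∀ k ≤ M, G k x = 0) :
    G 0 l = (-1) ^ (M + 1) / (M.factorial : ℝ) * ∫ y in l..x, G (M + 1) y * (y - l) ^ M := by
  have hc : ∀ k, Continuous (G k) := fun k =>
    continuous_iff_continuousAt.mpr fun y => (hG k y).continuousAt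
  induction M with
  | zero =>
    have := integral_eq_sub_of_hasDerivAt (fun y _ => hG 0 y) ((hc 1).intervalIntegrable l x)
    simp [this, h0 0 le_rfl]
  | succ M ih =>
    rw [ih fun k hk => h0 k (by omega)]
    have hv : ∀ y : ℝ, HasDerivAt (fun y : ℝ => (y - l) ^ (M + 1)) ((M + 1 : ℝ) * (y - l) ^ M) y := by
      intro y
      simpa using ((hasDerivAt_id y).sub_const l).fun_pow (M + 1)
    have key := integral_mul_deriv_eq_deriv_mul (a := l) (b := x) (fun y _ => hG (M + 1) y)
      (fun y _ => hv y) ((hc _).intervalIntegrable l x)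
      (Continuous.intervalIntegrable (by fun_prop) l x)
    rw [h0 (M + 1) le_rfl, sub_self, zero_pow (by omega), mul_zero, zero_mul, sub_zero,
      zero_sub] at key
    have e : ∀ y, G (M + 1) y * ((M + 1 : ℝ) * (y - l) ^ M) =
        (M + 1 : ℝ) * (G (M + 1) y * (y - l) ^ M) := fun y => by ring
    simp only [e, intervalIntegral.integral_const_mul] at key
    have hM : (M + 1 : ℝ) ≠ 0 := by positivity
    have hf : (M.factorial : ℝ) ≠ 0 := by positivity
    rw [← neg_eq_iff_eq_neg] at key
    rw [← key, Nat.factorial_succ]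
    push_cast
    field_simp
    ring

/-- The `k`-th derivative of `y ↦ e^{-uy} (1 - y / x) ^ j`. -/
noncomputable def truncExpDeriv (u x : ℝ) : ℕ → ℕ → ℝ → ℝ
  | j, 0, y => Real.exp (-(u * y)) * (1 - y / x) ^ j
  -- At `j = 0` the truncated `j - 1` is harmless: its coefficient is zero.
  | j, k + 1, y => -u * truncExpDeriv u x j k y - j / x * truncExpDeriv u x (j - 1) k y

theorem hasDerivAt_truncExpDeriv (u x : ℝ) (j k : ℕ) (y : ℝ) :
    HasDerivAt (truncExpDeriv u x j k) (truncExpDeriv u x j (k + 1) y) y := by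
  induction k generalizing j with
  | zero =>
    have h1 : HasDerivAt (fun y : ℝ => Real.exp (-(u * y))) (Real.exp (-(u * y)) * -u) y := by
      simpa using (((hasDerivAt_id y).const_mul u).neg).exp
    have h2 : HasDerivAt (fun y : ℝ => (1 - y / x) ^ j)
        (j * (1 - y / x) ^ (j - 1) * -(1 / x)) y := by
      simpa using ((((hasDerivAt_id y).div_const x).const_sub 1).fun_pow j)
    refine ((h1.mul h2).congr_deriv ?_)
    simp only [truncExpDeriv]
    ring
  | succ k ih => exact ((ih j).const_mul (-u)).sub ((ih (j - 1)).const_mul (j / x))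

/-- Each derivative lowers the power of `1 - y / x` by at most one. This removes the boundary terms
at `x` in Taylor's formula. -/
theorem truncExpDeriv_self {u x : ℝ} (hx : x ≠ 0) {j k : ℕ} (h : k < j) :
    truncExpDeriv u x j k x = 0 := by
  induction k generalizing j with
  | zero => simp [truncExpDeriv, div_self hx, h.ne']
  | succ k ih => simp [truncExpDeriv, ih (show k < j by omega), ih (show k < j - 1 by omega)]

/-- Each derivative costs at most a factor `u + j`, since `1 / x ≤ 1`; the bound is thus uniform in
`x`. -/
theorem abs_truncExpDeriv_le {u x : ℝ} (hu : 0 ≤ u) (hx : 1 ≤ x) (j k : ℕ) {y : ℝ} (hy : 0 ≤ y)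
    (hyx : y ≤ x) : |truncExpDeriv u x j k y| ≤ (u + j) ^ k * Real.exp (-(u * y)) := by
  have hx0 : 0 < x := by linarith
  induction k generalizing j with
  | zero =>
    have h0 : 0 ≤ 1 - y / x := by rw [sub_nonneg]; exact (div_le_one hx0).mpr hyx
    have h1 : 1 - y / x ≤ 1 := by linarith [div_nonneg hy hx0.le]
    rw [truncExpDeriv, abs_of_nonneg (by positivity), pow_zero, one_mul]
    exact mul_le_of_le_one_right (Real.exp_pos _).le (pow_le_one₀ h0 h1)
  | succ k ih =>
    have hj : ((j - 1 : ℕ) : ℝ) ≤ j := by exact_mod_cast Nat.sub_le j 1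
    have h2 : |truncExpDeriv u x (j - 1) k y| ≤ (u + j) ^ k * Real.exp (-(u * y)) :=
      (ih (j - 1)).trans (by gcongr)
    have h3 : (j : ℝ) / x ≤ j := div_le_self (by positivity) hx
    calc |truncExpDeriv u x j (k + 1) y|
        ≤ u * |truncExpDeriv u x j k y| + j / x * |truncExpDeriv u x (j - 1) k y| := by
          rw [truncExpDeriv]
          refine (abs_sub _ _).trans_eq ?_
          rw [abs_mul, abs_mul, abs_neg, abs_of_nonneg hu,
            abs_of_nonneg (show 0 ≤ (j : ℝ) / x by positivity)]
      _ ≤ u * ((u + j) ^ k * Real.exp (-(u * y))) + j * ((u + j) ^ k * Real.exp (-(u * y))) := by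
          gcongr
          exact ih j
      _ = (u + j) ^ (k + 1) * Real.exp (-(u * y)) := by ring

/-! ### Exponential decay of Riesz means -/

open MeasureTheory intervalIntegral Set in
theorem integral_mul_max_pow {E : ℝ → ℝ} (hE : Continuous E) {M : ℕ} (hM : M ≠ 0) {l x : ℝ}
    (hl : 0 ≤ l) :
    ∫ y in (0 : ℝ)..x, E y * (max (y - l) 0) ^ M = ∫ y in l..x, E y * (max (y - l) 0) ^ M := by
  have hc : Continuous fun y => E y * (max (y - l) 0) ^ M := by fun_prop
  rw [← integral_add_adjacent_intervals (hc.intervalIntegrable 0 l) (hc.intervalIntegrable l x)]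
  have h0 : ∫ y in (0 : ℝ)..l, E y * (max (y - l) 0) ^ M = ∫ _ in (0 : ℝ)..l, (0 : ℝ) := by
    refine intervalIntegral.integral_congr fun y hy => ?_
    rw [uIcc_of_le hl] at hy
    simp [max_eq_right (sub_nonpos.mpr hy.2), hM]
  rw [h0, intervalIntegral.integral_zero, zero_add]

/-- The positive part kills the terms with `λ_n ≥ y`, so the index set need not depend on `y` and
sum and integral can be interchanged. `M ≠ 0` excludes `0 ^ 0 = 1`. -/
theorem sum_mul_max_pow_eq (lam : Frequency) {M : ℕ} (hM : M ≠ 0) (a : ℕ → ℂ) (s : ℂ) {x y : ℝ}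
    (hy : 0 < y) (hyx : y ≤ x) :
    ∑ n ∈ lam.below x, a n * Complex.exp (-(lam n : ℂ) * s) * (((max (y - lam n) 0) ^ M : ℝ) : ℂ) =
      ((y ^ M : ℝ) : ℂ) * rieszMean lam M a y s := by
  rw [rieszMean, Finset.mul_sum]
  refine (Finset.sum_subset_zero_on_sdiff (lam.below_mono hyx) ?_ ?_).symm
  · intro n hn
    have : y ≤ lam n := not_lt.mp fun h => (Finset.mem_sdiff.mp hn).2 (Frequency.mem_below.mpr h)
    simp [max_eq_right (sub_nonpos.mpr this), hM]
  · intro n hn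
    have h1 := Frequency.mem_below.mp hn
    rw [max_eq_left (sub_nonneg.mpr h1.le), Real.rpow_natCast, mul_left_comm,
      ← Complex.ofReal_mul, ← mul_pow]
    congr 4
    field_simp

open MeasureTheory intervalIntegral Set in
/-- The Riesz mean of order `M + 1` at `s + u` as an integral over the Riesz means of order `M`
at `s`. -/
theorem rieszMean_add_eq_integral (lam : Frequency) {M : ℕ} (hM : M ≠ 0) (a : ℕ → ℂ) (s : ℂ)
    (u : ℝ) {x : ℝ} (hx : 0 < x) :
    rieszMean lam (M + 1 : ℕ) a x (s + u) =
      (((-1) ^ (M + 1) / (M.factorial : ℝ) : ℝ) : ℂ) * ∫ y in (0 : ℝ)..x,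
        (truncExpDeriv u x (M + 1) (M + 1) y : ℂ) * (((y ^ M : ℝ) : ℂ) * rieszMean lam M a y s) := by
  have hE : Continuous (truncExpDeriv u x (M + 1) (M + 1)) :=
    continuous_iff_continuousAt.mpr fun y => (hasDerivAt_truncExpDeriv _ _ _ _ y).continuousAt
  have h1 : ∀ n ∈ lam.below x, truncExpDeriv u x (M + 1) 0 (lam n) =
      (-1) ^ (M + 1) / (M.factorial : ℝ) *
        ∫ y in (0 : ℝ)..x, truncExpDeriv u x (M + 1) (M + 1) y * (max (y - lam n) 0) ^ M := by
    intro n hn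
    rw [integral_mul_max_pow hE hM (lam.nonneg n),
      taylor_integral_remainder_of_eq_zero (truncExpDeriv u x (M + 1))
        (hasDerivAt_truncExpDeriv u x (M + 1)) (lam n) x M
        fun k hk => truncExpDeriv_self hx.ne' (by omega)]
    congr 1
    refine intervalIntegral.integral_congr fun y hy => ?_
    rw [uIcc_of_le (Frequency.mem_below.mp hn).le] at hy
    simp only [max_eq_left (sub_nonneg.mpr hy.1)]
  have h2 : ∫ y in (0 : ℝ)..x,
      (truncExpDeriv u x (M + 1) (M + 1) y : ℂ) * (((y ^ M : ℝ) : ℂ) * rieszMean lam M a y s) =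
      ∫ y in (0 : ℝ)..x, ∑ n ∈ lam.below x, a n * Complex.exp (-(lam n : ℂ) * s) *
        ((truncExpDeriv u x (M + 1) (M + 1) y * (max (y - lam n) 0) ^ M : ℝ) : ℂ) := by
    refine integral_congr_ae (ae_of_all _ fun y hy => ?_)
    rw [uIoc_of_le hx.le] at hy
    rw [← sum_mul_max_pow_eq lam hM a s hy.1 hy.2, Finset.mul_sum]
    refine Finset.sum_congr rfl fun n _ => ?_
    push_cast
    ring
  rw [h2, integral_finsetSum fun n _ => Continuous.intervalIntegrable (by fun_prop) _ _,
    rieszMean, Finset.mul_sum]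
  refine Finset.sum_congr rfl fun n hn => ?_
  rw [intervalIntegral.integral_const_mul, intervalIntegral.integral_ofReal, mul_left_comm,
    ← Complex.ofReal_mul, ← h1 n hn, truncExpDeriv, Real.rpow_natCast, mul_add, Complex.exp_add]
  push_cast
  ring_nf

open MeasureTheory intervalIntegral Set in
/-- Riesz means decay exponentially to the right of a point where they are bounded. -/
theorem norm_rieszMean_add_le (lam : Frequency) {M : ℕ} (hM : M ≠ 0) (a : ℕ → ℂ) (s : ℂ) {K : ℝ}
    (hK : ∀ y : ℝ, 0 < y → ‖rieszMean lam M a y s‖ ≤ K) {u x : ℝ} (hu : 2 ≤ u) (hx : 1 ≤ x) :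
    ‖rieszMean lam (M + 1 : ℕ) a x (s + u)‖ ≤
      K * (u + (M + 1 : ℕ)) ^ (M + 1) * Real.exp (-((u - 2) * lam 0)) := by
  have hx0 : 0 < x := by linarith
  have hK0 : 0 ≤ K := (norm_nonneg _).trans (hK 1 one_pos)
  set C := K * (u + (M + 1 : ℕ)) ^ (M + 1) * Real.exp (-((u - 2) * lam 0)) with hC
  have hC0 : 0 ≤ C := by positivity
  have hf : (0 : ℝ) < M.factorial := by positivity
  have hbound : ∀ y ∈ Ioc 0 x, ‖(truncExpDeriv u x (M + 1) (M + 1) y : ℂ) *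
      (((y ^ M : ℝ) : ℂ) * rieszMean lam M a y s)‖ ≤ M.factorial * C * Real.exp (-y) := by
    intro y hy
    -- Below the first frequency the mean is an empty sum; beyond it, `y > λ₁` turns `e^{-uy}` into
    -- decay in `u`.
    rcases le_or_gt y (lam 0) with hy0 | hy0
    · have : lam.below y = ∅ := Finset.eq_empty_of_forall_notMem fun n hn => by
        have := Frequency.mem_below.mp hn
        linarith [lam.strictMono.monotone (Nat.zero_le n)]
      rw [rieszMean, this, Finset.sum_empty, mul_zero, mul_zero, norm_zero]
      positivity
    · rw [norm_mul, norm_mul, Complex.norm_real, Complex.norm_real, Real.norm_eq_abs,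
        Real.norm_of_nonneg (pow_nonneg hy.1.le M)]
      have e1 := abs_truncExpDeriv_le (by linarith : 0 ≤ u) hx (M + 1) (M + 1) hy.1.le hy.2
      -- Of the exponent `u`, one unit absorbs `y ^ M` and another is kept as the integrable
      -- `e^{-y}`; hence `u - 2`.
      have e2 : y ^ M ≤ M.factorial * Real.exp y := by
        rw [mul_comm, ← div_le_iff₀ hf]
        exact Real.pow_div_factorial_le_exp y hy.1.le M
      have e3 : Real.exp (-(u * y)) * Real.exp y ≤
          Real.exp (-((u - 2) * lam 0)) * Real.exp (-y) := by
        rw [← Real.exp_add, ← Real.exp_add, Real.exp_le_exp]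
        nlinarith
      calc |truncExpDeriv u x (M + 1) (M + 1) y| * (y ^ M * ‖rieszMean lam M a y s‖)
          ≤ ((u + (M + 1 : ℕ)) ^ (M + 1) * Real.exp (-(u * y))) *
              ((M.factorial * Real.exp y) * K) := by
            have := hy.1
            have := hK y hy.1
            refine mul_le_mul e1 (mul_le_mul e2 this ?_ ?_) ?_ ?_ <;> positivity
        _ = M.factorial * K * (u + (M + 1 : ℕ)) ^ (M + 1) *
              (Real.exp (-(u * y)) * Real.exp y) := by ring
        _ ≤ M.factorial * K * (u + (M + 1 : ℕ)) ^ (M + 1) *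
              (Real.exp (-((u - 2) * lam 0)) * Real.exp (-y)) := by gcongr
        _ = _ := by rw [hC]; ring
  have h1 : ‖∫ y in (0 : ℝ)..x, (truncExpDeriv u x (M + 1) (M + 1) y : ℂ) *
      (((y ^ M : ℝ) : ℂ) * rieszMean lam M a y s)‖ ≤ M.factorial * C := by
    refine (norm_integral_le_of_norm_le hx0.le (ae_of_all _ hbound)
      (Continuous.intervalIntegrable (by fun_prop) _ _)).trans ?_
    rw [intervalIntegral.integral_const_mul]
    refine mul_le_of_le_one_right (by positivity) ?_
    rw [intervalIntegral.integral_comp_neg, integral_exp]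
    simp [(Real.exp_pos _).le]
  rw [rieszMean_add_eq_integral lam hM a s u hx0, norm_mul, Complex.norm_real, norm_div, norm_pow,
    norm_neg, norm_one, one_pow, Real.norm_of_nonneg hf.le, one_div_mul_eq_div, div_le_iff₀ hf]
  linarith

/-! ### From the real axis to the half-plane -/

/-- A function with a Riesz germ decays exponentially along the positive real axis. -/
theorem IsRieszGerm.exists_norm_le_exp {lam : Frequency} (hlam : 0 < lam 0) {a : ℕ → ℂ}
    {f : ℂ → ℂ} (h : IsRieszGerm lam a f) :
    ∃ c > 0, ∀ᶠ x : ℝ in Filter.atTop, ‖f x‖ ≤ Real.exp (-(c * x)) := by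
  obtain ⟨m, hm, σ, h⟩ := h
  set s : ℝ := max σ 0 + 1 with hs
  have hsσ : σ < s := by linarith [le_max_left σ 0]
  have hs0 : 0 < s := by linarith [le_max_right σ 0]
  set M : ℕ := ⌈m⌉₊ + 1 with hMdef
  have hM : m + 1 ≤ M := by
    rw [hMdef]
    push_cast
    linarith [Nat.le_ceil m]
  have hcons : ∀ p : ℝ, m + 1 ≤ p → ∀ r : ℝ, s ≤ r →
      Filter.Tendsto (fun x : ℝ => rieszMean lam p a x r) Filter.atTop (nhds (f r)) := by
    intro p hp r hr
    exact tendsto_rieszMean_of_le lam hm hp a r _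
      (h r (by simpa using by linarith) (by simpa using by linarith))
  obtain ⟨K, -, hK⟩ := exists_norm_rieszMean_le lam (Nat.cast_nonneg M) a s _ (hcons M hM s le_rfl)
  have hdecay : ∀ u : ℝ, 2 ≤ u → ‖f ((s + u : ℝ) : ℂ)‖ ≤
      K * (u + (M + 1 : ℕ)) ^ (M + 1) * Real.exp (-((u - 2) * lam 0)) := by
    intro u hu
    refine le_of_tendsto (hcons (M + 1 : ℕ) (by push_cast; linarith) (s + u) (by linarith)).norm ?_
    filter_upwards [Filter.eventually_ge_atTop 1] with x hx
    rw [Complex.ofReal_add]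
    exact norm_rieszMean_add_le lam (Nat.succ_ne_zero _) a s hK hu hx
  -- Half of the rate `λ₁` is spent on the polynomial factor in `u`.
  refine ⟨lam 0 / 2, by positivity, ?_⟩
  set d : ℝ := ((M + 1 : ℕ) : ℝ)
  set A : ℝ := K * Real.exp ((s + d) * (lam 0 / 2) + 2 * lam 0) with hA
  have hlim : Filter.Tendsto (fun y : ℝ => A * (y ^ (M + 1) * Real.exp (-(lam 0 / 2) * y)))
      Filter.atTop (nhds 0) := by
    have := (tendsto_rpow_mul_exp_neg_mul_atTop_nhds_zero (M + 1 : ℕ) (lam 0 / 2)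
      (by positivity)).const_mul A
    simpa only [Real.rpow_natCast, mul_zero] using this
  have hshift : Filter.Tendsto (fun x : ℝ => x + (d - s)) Filter.atTop Filter.atTop :=
    Filter.tendsto_atTop_add_const_right _ _ Filter.tendsto_id
  filter_upwards [(hlim.comp hshift).eventually_le_const one_pos,
    Filter.eventually_ge_atTop (s + 2)] with x hx1 hx2
  have h1 := hdecay (x - s) (by linarith)
  rw [add_sub_cancel] at h1
  refine h1.trans ?_
  have h2 : K * (x - s + d) ^ (M + 1) * Real.exp (-((x - s - 2) * lam 0)) =
      A * ((x + (d - s)) ^ (M + 1) * Real.exp (-(lam 0 / 2) * (x + (d - s)))) *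
        Real.exp (-(lam 0 / 2 * x)) := by
    rw [hA, show x - s + d = x + (d - s) by ring,
      show -((x - s - 2) * lam 0) = ((s + d) * (lam 0 / 2) + 2 * lam 0) + -(lam 0 / 2) * (x + (d - s)) + -(lam 0 / 2 * x) by ring,
      Real.exp_add, Real.exp_add]
    ring
  rw [h2]
  exact mul_le_of_le_one_left (Real.exp_pos _).le hx1

theorem exists_norm_le_of_growthNorm_lt_top {l : ℝ} {f : ℂ → ℂ} (h : growthNorm l f < ⊤) :
    ∃ C : ℝ, 0 ≤ C ∧ ∀ s : ℂ, 0 < s.re → ‖f s‖ ≤ C * (1 + ‖s‖) ^ l := by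
  refine ⟨(growthNorm l f).toReal, ENNReal.toReal_nonneg, fun s hs => ?_⟩
  have h1 : ENNReal.ofReal (‖f s‖ / (1 + ‖s‖) ^ l) ≤ growthNorm l f :=
    le_iSup₂ (f := fun (s : ℂ) (_ : 0 < s.re) => ENNReal.ofReal (‖f s‖ / (1 + ‖s‖) ^ l)) s hs
  have h2 := (ENNReal.ofReal_le_iff_le_toReal h.ne).mp h1
  rwa [div_le_iff₀ (by positivity)] at h2

open Complex Filter Asymptotics Bornology in
/-- Exponential decay along the real axis spreads to a half-plane for functions of polynomial
growth, by the Phragmén–Lindelöf principle. -/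
theorem exists_norm_le_mul_exp {l c C : ℝ} (hl : 0 ≤ l) (hc : 0 < c) (hC : 0 ≤ C) {f : ℂ → ℂ}
    (hd : DifferentiableOn ℂ f {s : ℂ | 0 < s.re})
    (hf : ∀ s : ℂ, 0 < s.re → ‖f s‖ ≤ C * (1 + ‖s‖) ^ l)
    (hr : ∀ᶠ x : ℝ in atTop, ‖f x‖ ≤ Real.exp (-(c * x))) :
    ∃ A : ℝ, 0 ≤ A ∧ ∀ s : ℂ, 1 ≤ s.re →
      ‖f s‖ ≤ A * (1 + ‖s‖) ^ l * Real.exp (-(c * s.re)) := by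
  -- The shift by 1 makes `g` holomorphic across the imaginary axis; `z + 2` stays off the branch
  -- cut and satisfies `1 + |z + 1| ≤ 2 |z + 2|` for `Re z ≥ 0`.
  set g : ℂ → ℂ := fun z => f (z + 1) * exp (c * z) / (z + 2) ^ (l : ℂ) with hg
  have hone : ∀ z : ℂ, 0 ≤ z.re → 1 ≤ ‖z + 2‖ ∧ ‖z + 1‖ ≤ ‖z + 2‖ := by
    intro z hz
    constructor
    · have := re_le_norm (z + 2)
      simp only [add_re, re_ofNat] at this
      linarith
    · rw [norm_def, norm_def]
      refine Real.sqrt_le_sqrt ?_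
      simp only [normSq_apply, add_re, add_im, one_re, one_im, re_ofNat, im_ofNat]
      nlinarith
  have hgn : ∀ z : ℂ, ‖g z‖ = ‖f (z + 1)‖ * Real.exp (c * z.re) / ‖z + 2‖ ^ l := by
    intro z
    simp only [hg, norm_div, norm_mul, norm_exp, norm_cpow_real]
    simp
  have hgb : ∀ z : ℂ, 0 ≤ z.re → ‖g z‖ ≤ C * 2 ^ l * Real.exp (c * z.re) := by
    intro z hz
    obtain ⟨h1, h2⟩ := hone z hz
    have h3 : ‖f (z + 1)‖ ≤ C * (2 ^ l * ‖z + 2‖ ^ l) := by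
      refine (hf (z + 1) (by simpa using by linarith)).trans ?_
      rw [← Real.mul_rpow (by norm_num) (norm_nonneg _)]
      gcongr
      linarith
    rw [hgn, div_le_iff₀ (by positivity)]
    calc _ ≤ C * (2 ^ l * ‖z + 2‖ ^ l) * Real.exp (c * z.re) := by gcongr
      _ = _ := by ring
  have hgd : DifferentiableOn ℂ g {z : ℂ | -1 < z.re} := by
    intro z hz
    have hz : -1 < z.re := hz
    have h1 : DifferentiableAt ℂ f (z + 1) := hd.differentiableAt
      ((isOpen_lt continuous_const continuous_re).mem_nhds (by simpa using by linarith))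
    have h2 : z + 2 ∈ slitPlane := Or.inl (by simpa using by linarith)
    have h3 : (z + 2) ^ (l : ℂ) ≠ 0 := by
      rw [Ne, cpow_eq_zero_iff, not_and_or]
      exact Or.inl (slitPlane_ne_zero h2)
    have h4 : DifferentiableAt ℂ (fun z : ℂ => f (z + 1)) z := h1.comp z (by fun_prop)
    have h5 : DifferentiableAt ℂ (fun z : ℂ => (z + 2) ^ (l : ℂ)) z :=
      DifferentiableAt.cpow_const (by fun_prop) h2
    exact ((h4.mul (by fun_prop)).div h5 h3).differentiableWithinAt
  have hcl : DiffContOnCl ℂ g {z : ℂ | 0 < z.re} := by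
    refine (hgd.mono ?_).diffContOnCl
    rw [closure_setOfPred_lt_re]
    exact fun z hz => show -1 < z.re from lt_of_lt_of_le (by norm_num) hz
  have hmain : ∀ z : ℂ, 0 ≤ z.re → ‖g z‖ ≤ C * 2 ^ l := by
    intro z hz
    -- `g` has exponential type, order `1 < 2`. It is bounded on the imaginary axis, where `e^{cz}`
    -- has modulus 1, and on the real axis by the assumed decay.
    refine PhragmenLindelof.right_half_plane_of_bounded_on_real hcl ⟨1, by norm_num, c, ?_⟩ ?_ ?_ hz
    · refine IsBigO.of_bound (C * 2 ^ l) (Filter.Eventually.filter_mono inf_le_right ?_)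
      rw [eventually_principal]
      intro w hw
      have hw : 0 < w.re := hw
      rw [Real.rpow_one, Real.norm_of_nonneg (Real.exp_pos _).le]
      refine (hgb w hw.le).trans ?_
      gcongr
      exact re_le_norm w
    · refine isBoundedUnder_of_eventually_le (a := 1) ?_
      filter_upwards [(tendsto_atTop_add_const_right atTop (1 : ℝ) tendsto_id).eventually hr,
        eventually_ge_atTop 0] with x hx hx0
      simp only [id_eq, ofReal_add, ofReal_one] at hx
      have h1 : (1 : ℝ) ≤ ‖(x : ℂ) + 2‖ ^ l :=
        Real.one_le_rpow (hone x (by simpa using hx0)).1 hl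
      rw [hgn, ofReal_re]
      refine div_le_one_of_le₀ (le_trans ?_ h1) (by positivity)
      calc ‖f (x + 1)‖ * Real.exp (c * x) ≤ Real.exp (-(c * (x + 1))) * Real.exp (c * x) := by
            gcongr
        _ = Real.exp (-c) := by rw [← Real.exp_add]; ring_nf
        _ ≤ 1 := Real.exp_le_one_iff.mpr (by linarith)
    · intro x
      simpa using hgb (x * I) (by simp)
  refine ⟨C * 2 ^ l * Real.exp c, by positivity, fun s hs => ?_⟩
  have h1 := hmain (s - 1) (by simpa using hs)
  have h2 : s - 1 + 2 = s + 1 := by ring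
  have h3 : 0 < ‖s + 1‖ := by
    have := (hone (s - 1) (by simpa using hs)).1
    rw [h2] at this
    linarith
  rw [hgn, sub_add_cancel, h2, div_le_iff₀ (by positivity)] at h1
  have h4 : ‖s + 1‖ ≤ 1 + ‖s‖ := by
    rw [add_comm 1]
    exact (norm_add_le s 1).trans_eq (by simp)
  calc ‖f s‖ = ‖f s‖ * Real.exp (c * (s - 1).re) * Real.exp (-(c * (s - 1).re)) := by
        rw [mul_assoc, ← Real.exp_add, add_neg_cancel, Real.exp_zero, mul_one]
    _ ≤ C * 2 ^ l * ‖s + 1‖ ^ l * Real.exp (-(c * (s - 1).re)) := by gcongr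
    _ ≤ C * 2 ^ l * (1 + ‖s‖) ^ l * Real.exp (-(c * (s - 1).re)) := by gcongr
    _ = C * 2 ^ l * Real.exp c * (1 + ‖s‖) ^ l * Real.exp (-(c * s.re)) := by
      rw [show -(c * (s - 1).re) = c + -(c * s.re) by rw [sub_re, one_re]; ring, Real.exp_add]
      ring

/-! ### The two limits -/

theorem tendsto_mul_rpow_mul_exp {c : ℝ} (hc : 0 < c) (A l : ℝ) :
    Filter.Tendsto (fun x : ℝ => A * (1 + x) ^ l * Real.exp (-(c * x))) Filter.atTop (nhds 0) := by
  have h := ((tendsto_rpow_mul_exp_neg_mul_atTop_nhds_zero l c hc).comp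
    (Filter.tendsto_atTop_add_const_left Filter.atTop 1 Filter.tendsto_id)).const_mul
      (A * Real.exp c)
  rw [mul_zero] at h
  refine h.congr fun x => ?_
  simp only [Function.comp_apply, id_eq]
  rw [show -c * (1 + x) = -c + -(c * x) by ring, Real.exp_add, Real.exp_neg]
  field_simp

theorem mainTheorem11 (l : ℝ) (hl : 0 ≤ l) (lam : Frequency) (hlam : 0 < lam 0)
    (f : ℂ → ℂ) (hf : f ∈ RieszHolSpace lam l) :
    Filter.Tendsto
      (fun σ : ℝ => ⨆ (s : ℂ) (_ : σ < s.re), ENNReal.ofReal (‖f s‖ / (1 + ‖s‖) ^ l))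
      Filter.atTop (nhds 0) ∧
    Filter.Tendsto
      (fun σ : ℝ => ⨆ (δ : ℝ) (_ : σ ≤ δ) (t : ℝ),
        ENNReal.ofReal (‖f ((δ : ℂ) + (t : ℂ) * Complex.I)‖ / (1 + |t|) ^ l))
      Filter.atTop (nhds 0) := by
  obtain ⟨hd, ⟨a, ha⟩, hg⟩ := hf
  obtain ⟨C, hC, hfC⟩ := exists_norm_le_of_growthNorm_lt_top hg
  obtain ⟨c, hc, hr⟩ := ha.exists_norm_le_exp hlam
  obtain ⟨A, hA, hfA⟩ := exists_norm_le_mul_exp hl hc hC hd hfC hr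
  constructor
  · rw [ENNReal.tendsto_nhds_zero]
    intro ε hε
    have h0 := ENNReal.tendsto_ofReal (tendsto_mul_rpow_mul_exp hc A 0)
    rw [ENNReal.ofReal_zero, ENNReal.tendsto_nhds_zero] at h0
    filter_upwards [h0 ε hε, Filter.eventually_ge_atTop 1] with σ h1 hσ
    refine iSup₂_le fun s hs => (ENNReal.ofReal_le_ofReal ?_).trans h1
    rw [div_le_iff₀ (by positivity), Real.rpow_zero, mul_one]
    calc ‖f s‖ ≤ A * (1 + ‖s‖) ^ l * Real.exp (-(c * s.re)) := hfA s (by linarith)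
      _ ≤ A * (1 + ‖s‖) ^ l * Real.exp (-(c * σ)) := by gcongr
      _ = _ := by ring
  · rw [ENNReal.tendsto_nhds_zero]
    intro ε hε
    have h0 := ENNReal.tendsto_ofReal (tendsto_mul_rpow_mul_exp hc A l)
    rw [ENNReal.ofReal_zero, ENNReal.tendsto_nhds_zero] at h0
    -- The majorant need not be monotone in `δ`, so a threshold valid for every larger `δ` is
    -- needed.
    obtain ⟨X, hX⟩ := (h0 ε hε).exists_forall_of_atTop
    filter_upwards [Filter.eventually_ge_atTop (max X 1)] with σ hσ
    refine iSup₂_le fun δ hδ => iSup_le fun t =>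
      (ENNReal.ofReal_le_ofReal ?_).trans (hX δ ((le_max_left _ _).trans (hσ.trans hδ)))
    have hδ1 : 1 ≤ δ := (le_max_right _ _).trans (hσ.trans hδ)
    -- Separates the weight in `t` from a power of `1 + δ`, which the exponential beats.
    have hn : 1 + ‖(δ : ℂ) + t * Complex.I‖ ≤ (1 + δ) * (1 + |t|) := by
      have := norm_add_le (δ : ℂ) (t * Complex.I)
      rw [norm_mul, Complex.norm_I, mul_one, Complex.norm_real, Complex.norm_real,
        Real.norm_of_nonneg (by linarith : 0 ≤ δ), Real.norm_eq_abs] at this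
      nlinarith [abs_nonneg t]
    rw [div_le_iff₀ (by positivity)]
    have h2 := hfA (δ + t * Complex.I) (by simpa using hδ1)
    rw [show ((δ : ℂ) + t * Complex.I).re = δ by simp] at h2
    calc _ ≤ _ := h2
      _ ≤ A * ((1 + δ) * (1 + |t|)) ^ l * Real.exp (-(c * δ)) := by gcongr
      _ = _ := by
        rw [Real.mul_rpow (by linarith) (by positivity)]
        ring
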